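/- Let $d\in\mathbb N_0$, $\Omega=(\mathbb R\setminus\{0\})^d$, and write $xy=(x_1y_1,\dots,x_dy_d)$ and $1/x=(1/x_1,\dots,1/x_d)$ for $x,y\in\Omega$. Distributions are real- or complex-valued. Let $\mathcal D'_H(\Omega)$ be the set of all distributions $T\in\mathcal D'(\Omega)$ such that 1. for every test function $\varphi\in\mathcal D(\Omega)$ the function $y\mapsto T_x\varphi(xy)$, $y\in\Omega$, belongs to $\mathcal D(\Omega)$, and 2. for every compact $K\subset\Omega$ the set $(1/\operatorname{supp}T)\,K=\{(1/x)k : x\in\operatorname{supp}T,\ k\in K\}$ is relatively compact in $\Omega$, where $\operatorname{supp}T\subset\Omega$ is the support of $T$ in $\Omega$. Let $\mathcal E'(\Omega)$ be the set of all $T\in\mathcal D'(\Omega)$ with compact support in $\Omega$. Then $$\mathcal D'_H(\Omega)=\mathcal E'(\Omega).$$ Moreover, condition 1 alone already implies $T\in\mathcal E'(\Omega)$. -/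

import Mathlib

open scoped Distributions

noncomputable section

namespace MulConv

/-- The open set `(ℝ ∖ {0})^d` of all points of `ℝ^d` off the coordinate hyperplanes. Products,
inverses and the unit `1 = (1, …, 1)` in `Fin d → ℝ` are coordinatewise. -/
def nonzeroReals (d : ℕ) : TopologicalSpace.Opens (Fin d → ℝ) where
  carrier := {x | ∀ i, x i ≠ 0}
  is_open' := by
    simp only [Set.ofPred_forall]
    exact isOpen_iInter_of_finite fun i => isOpen_ne_fun (continuous_apply i) continuous_const

/-- The invertible dilation `x ↦ x y`, for `y ∈ (ℝ ∖ {0})^d`, as a homeomorphism of `ℝ^d`. -/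
def dilationHomeo {d : ℕ} (y : nonzeroReals d) : (Fin d → ℝ) ≃ₜ (Fin d → ℝ) where
  toFun x := x * (y : Fin d → ℝ)
  invFun x := x * (y : Fin d → ℝ)⁻¹
  left_inv x := by
    ext i
    have := y.2 i
    simp [this]
  right_inv x := by
    ext i
    have := y.2 i
    simp [this]
  continuous_toFun := by fun_prop
  continuous_invFun := by fun_prop

/-- For `y ∈ (ℝ ∖ {0})^d` and a test function `φ` on `(ℝ ∖ {0})^d`, the test function
`x ↦ φ (x y)` on `(ℝ ∖ {0})^d`. -/
def dilate {d : ℕ} (y : nonzeroReals d) (φ : 𝓓(nonzeroReals d, ℝ)) : 𝓓(nonzeroReals d, ℝ) where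
  toFun x := φ (x * (y : Fin d → ℝ))
  contDiff' := φ.contDiff.comp (contDiff_id.mul contDiff_const)
  hasCompactSupport' := φ.hasCompactSupport.comp_homeomorph (dilationHomeo y)
  tsupport_subset' := by
    intro x hx i hi
    have h : x * (y : Fin d → ℝ) ∈ tsupport φ :=
      tsupport_comp_subset_preimage φ (dilationHomeo y).continuous hx
    exact φ.tsupport_subset h i (by simp [hi])

/-- The support of a distribution on `(ℝ ∖ {0})^d`, as a relatively closed subset of
`(ℝ ∖ {0})^d`: the points of `(ℝ ∖ {0})^d` without a neighbourhood on which `T` vanishes.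
(`Distribution.dsupport` takes the closed support in the whole of `ℝ^d`, which can contain points
of the coordinate hyperplanes.) -/
def support {𝕜 : Type*} [RCLike 𝕜] {d : ℕ} (T : 𝓓'(nonzeroReals d, 𝕜)) : Set (Fin d → ℝ) :=
  Distribution.dsupport T ∩ nonzeroReals d

/-- The space `𝓔'((ℝ ∖ {0})^d)` of distributions on `(ℝ ∖ {0})^d` with compact support. -/
def compactlySupported (𝕜 : Type*) [RCLike 𝕜] (d : ℕ) : Set 𝓓'(nonzeroReals d, 𝕜) :=
  {T | IsCompact (support T)}

/-- `y ↦ T_x φ(x y)` is a test function on `(ℝ ∖ {0})^d` for every test function `φ` on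
`(ℝ ∖ {0})^d`. (As for distributions in Mathlib, `T` is applied to real-valued `φ`; for complex
`T` the condition for complex-valued `φ` follows by linearity.) -/
def PreservesTestFunctions {𝕜 : Type*} [RCLike 𝕜] {d : ℕ} (T : 𝓓'(nonzeroReals d, 𝕜)) : Prop :=
  ∀ φ : 𝓓(nonzeroReals d, ℝ), ∃ ψ : 𝓓(nonzeroReals d, 𝕜),
    ∀ y : nonzeroReals d, ψ (y : Fin d → ℝ) = T (dilate y φ)

/-- `A ⊂⊂ Ω`: the set `A` is relatively compact in `Ω`. -/
def IsRelativelyCompactIn {X : Type*} [TopologicalSpace X] (A Ω : Set X) : Prop :=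
  IsCompact (closure A) ∧ closure A ⊆ Ω

/-- The space `𝓓'_H(Ω)` for `Ω = (ℝ ∖ {0})^d`, which is its own closure `⋃ a Ω` under invertible
dilations: all `T ∈ 𝓓'(Ω)` such that `T_x φ(x ·) ∈ 𝓓(Ω)` for all `φ ∈ 𝓓(Ω)`, and
`(1 / supp T) K ⊂⊂ Ω` for every compact `K ⊆ Ω`. -/
def hadamardDistributions (𝕜 : Type*) [RCLike 𝕜] (d : ℕ) : Set 𝓓'(nonzeroReals d, 𝕜) :=
  {T | PreservesTestFunctions T ∧
    ∀ K : Set (Fin d → ℝ), IsCompact K → K ⊆ nonzeroReals d →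
      IsRelativelyCompactIn (Set.image2 (fun x k => x⁻¹ * k) (support T) K) (nonzeroReals d)}

end MulConv

end

/-! Condition 1 forces compact support by a gliding hump. If `support T` lies in no box of an
exhaustion of `Ω`, pick `x n` in it outside the `n`-th box and a bump `u n` near `x n` with `T (u n)
≠ 0`. Rescaling by `x n` moves all the bumps into one compact ball `B` around `1`, and the
functionals `Λ n g = T (g (· / x n))` on `𝓓_B` are each nonzero. A Baire argument
(`exists_frequently_ne_zero`) gives a single `g` with `Λ n g ≠ 0` infinitely often. So `y ↦ T_x g(x
y)` is nonzero at infinitely many `1 / x n`; as these points leave every compact subset of `Ω`, it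
is no test function.

Conversely, if `T` has compact support, `y ↦ T_x φ(x y)` vanishes off the compact set `(1 / supp T)
supp φ`. It is smooth because `T` has finite order on a fixed compact set and Taylor remainders are
small with all their derivatives. Condition 2 holds since `(1 / supp T) K` is a continuous image of
a compact set. -/

open scoped BoundedContinuousFunction

/-! ### Series of test functions and the gliding hump -/

namespace ContDiffMapSupportedIn

open TopologicalSpace Filter Topology

variable {E F : Type*} [NormedAddCommGroup E] [NormedSpace ℝ E]
  [NormedAddCommGroup F] [NormedSpace ℝ F] {K : Compacts E}

/-- A series in `𝓓_{K}(E, F)` converges as soon as all the series of seminorms do. -/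
theorem exists_hasSum [CompleteSpace F] {ι : Type*} {f : ι → 𝓓_{K}(E, F)}
    (hf : ∀ i, Summable fun n => N[ℝ]_{K, i} (f n)) : ∃ g : 𝓓_{K}(E, F), HasSum f g := by
  have hbound : ∀ (k : ℕ) (n : ι) (x : E), (k : ℕ∞) ≤ ⊤ →
      ‖iteratedFDeriv ℝ k (f n) x‖ ≤ N[ℝ]_{K, k} (f n) :=
    fun k n x _ => norm_iteratedFDeriv_apply_le_seminorm_top ℝ
  have hdiff : ∀ n, ContDiff ℝ (⊤ : ℕ∞) (f n) := fun n => (f n).contDiff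
  obtain ⟨g, hg⟩ : ∃ g : 𝓓_{K}(E, F), (g : E → F) = fun x => ∑' n, f n x :=
    ⟨⟨_, contDiff_tsum hdiff (fun k _ => hf k) hbound,
      fun x hx => by simp [fun n => (f n).zero_on_compl hx]⟩, rfl⟩
  refine ⟨g, ?_⟩
  rw [HasSum, (ContDiffMapSupportedIn.withSeminorms ℝ E F ⊤ K).tendsto_nhds]
  intro i ε hε
  -- The `i`-th seminorm is the sup norm of the `i`-th derivative, so convergence reduces to the
  -- Banach space of bounded continuous functions.
  have hs : Summable fun n => structureMapCLM ℝ ⊤ i (f n) := 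
    Summable.of_norm (E := E →ᵇ (E [×i]→L[ℝ] F)) (hf i)
  have hgi : structureMapCLM ℝ ⊤ i g = ∑' n, structureMapCLM ℝ ⊤ i (f n) := by
    ext1 x
    rw [← BoundedContinuousFunction.evalCLM_apply ℝ x (∑' n, _), ContinuousLinearMap.map_tsum _ hs,
      structureMapCLM_top_apply, hg]
    refine (iteratedFDeriv_tsum_apply hdiff (fun k _ => hf k) hbound (k := i) le_top x).trans ?_
    simp only [BoundedContinuousFunction.evalCLM_apply, structureMapCLM_top_apply]
  have hsum := hs.hasSum
  rw [← hgi] at hsum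
  filter_upwards [Metric.tendsto_nhds.1 hsum ε hε] with s hs
  rw [ContDiffMapSupportedIn.seminorm_apply, map_sub, map_sum]
  exact (dist_eq_norm (E := E →ᵇ (E [×i]→L[ℝ] F)) _ _).symm.trans_lt hs

/-- Every element of `𝓓_{K}(E, F)` has a positive multiple with small first seminorms. -/
theorem exists_pos_smul_seminorm_le (f : 𝓓_{K}(E, F)) (n : ℕ) {ε : ℝ} (hε : 0 < ε) :
    ∃ t : ℝ, 0 < t ∧ ∀ i ≤ n, N[ℝ]_{K, i} (t • f) ≤ ε := by
  set M := ∑ i ∈ Finset.range (n + 1), N[ℝ]_{K, i} f with hM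
  have hM0 : 0 ≤ M := Finset.sum_nonneg fun i _ => apply_nonneg _ _
  refine ⟨ε / (M + 1), by positivity, fun i hi => ?_⟩
  have : N[ℝ]_{K, i} f ≤ M :=
    Finset.single_le_sum (f := fun i => N[ℝ]_{K, i} f) (fun i _ => apply_nonneg _ _)
      (Finset.mem_range.2 (by omega))
  rw [map_smul_eq_mul, Real.norm_of_nonneg (by positivity), div_mul_eq_mul_div,
    div_le_iff₀ (by positivity)]
  gcongr
  linarith

/-- If `Λ n (f n) ≠ 0` for all `n`, then some `g` satisfies `Λ n g ≠ 0` for infinitely many `n`. -/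
theorem exists_frequently_ne_zero [CompleteSpace F] {G : Type*} [NormedAddCommGroup G]
    [NormedSpace ℝ G] [FiniteDimensional ℝ G] (Λ : ℕ → 𝓓_{K}(E, F) →L[ℝ] G)
    (f : ℕ → 𝓓_{K}(E, F)) (hf : ∀ n, Λ n (f n) ≠ 0) :
    ∃ g : 𝓓_{K}(E, F), ∃ᶠ n in atTop, Λ n g ≠ 0 := by
  -- For each fixed `i`, the `i`-th seminorm of `t n • f n` is at most `2⁻ⁿ` once `n ≥ i`, so every
  -- subseries converges.
  choose t ht0 ht using fun n : ℕ =>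
    exists_pos_smul_seminorm_le (f n) n (ε := (1 / 2) ^ n) (by positivity)
  have hsum (c : ℕ → Bool) : ∃ g : 𝓓_{K}(E, F), HasSum (fun n => if c n then t n • f n else 0) g := by
    refine exists_hasSum fun i => ?_
    refine summable_geometric_two.of_norm_bounded_eventually_nat ?_
    filter_upwards [eventually_ge_atTop i] with n hn
    rw [Real.norm_of_nonneg (apply_nonneg _ _)]
    split_ifs
    · exact ht n i hn
    · rw [map_zero]
      positivity
  choose S hS using hsum
  by_contra! hcon
  have hΛ (m : ℕ) (c : ℕ → Bool) :
      HasSum (fun n => if c n then Λ m (t n • f n) else 0) (Λ m (S c)) := by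
    simpa [apply_ite (Λ m), Function.comp_def] using! (Λ m).hasSum (hS c)
  have hcont (m : ℕ) : Continuous fun c : ℕ → Bool => Λ m (S c) := by
    -- In finite dimension summability is absolute; the full series then majorizes all subseries
    -- uniformly in `c`.
    have hn : Summable fun n => ‖Λ m (t n • f n)‖ := by
      simpa using (hΛ m fun _ => true).summable.norm
    simp_rw [← fun c => (hΛ m c).tsum_eq]
    refine continuous_tsum (fun n => ?_) hn fun n c => ?_
    · exact (continuous_of_discreteTopology (f := fun b : Bool =>
        if b then Λ m (t n • f n) else 0)).comp (continuous_apply n)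
    · split_ifs
      · exact le_rfl
      · simp
  -- Baire's theorem on the Cantor space `ℕ → Bool`.
  obtain ⟨N, c, hc⟩ := nonempty_interior_of_iUnion_of_closed
    (f := fun N : ℕ => {c : ℕ → Bool | ∀ m ≥ N, Λ m (S c) = 0})
    (fun N => by
      simp only [Set.ofPred_forall]
      exact isClosed_iInter fun m => isClosed_iInter fun _ =>
        isClosed_eq (hcont m) continuous_const)
    (Set.eq_univ_of_forall fun c => by
      simpa [eventually_atTop] using hcon (S c))
  -- Flipping a far coordinate `m` stays near `c`, yet changes `Λ m (S c)` by `± Λ m (t m • f m) ≠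
  -- 0`.
  have hlim : Tendsto (fun m => Function.update c m (!c m)) atTop (𝓝 c) := by
    refine tendsto_pi_nhds.2 fun n => tendsto_const_nhds.congr' ?_
    filter_upwards [eventually_gt_atTop n] with m hm
    rw [Function.update_of_ne hm.ne]
  obtain ⟨m, hm, hmN⟩ := ((hlim.eventually_mem (mem_interior_iff_mem_nhds.1 hc)).and
    (eventually_ge_atTop N)).exists
  have h1 := hΛ m c
  have h2 := hΛ m (Function.update c m (!c m))
  rw [interior_subset hc m hmN] at h1
  rw [hm m hmN] at h2
  have h3 := hasSum_single (f := fun n =>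
    (if Function.update c m (!c m) n then Λ m (t n • f n) else 0) -
      (if c n then Λ m (t n • f n) else 0)) m (fun n hn => by
        simp [Function.update_of_ne hn])
  have h4 := h3.unique (h2.sub h1)
  rcases hcm : c m <;> simp [hcm, (ht0 m).ne', hf m] at h4

end ContDiffMapSupportedIn

/-! ### Supports and finite order of distributions -/

namespace Distribution

open TopologicalSpace Filter Topology Set
open scoped Manifold ContDiff

variable {E : Type*} [NormedAddCommGroup E] [NormedSpace ℝ E] {Ω : Opens E}
  {F : Type*} [AddCommGroup F] [Module ℝ F] [TopologicalSpace F]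

/-- A distribution vanishing on two open sets vanishes on their union. -/
theorem IsVanishingOn.union [FiniteDimensional ℝ E] {T : 𝓓'(Ω, F)} {V₁ V₂ : Set E}
    (h₁ : IsVanishingOn T V₁) (h₂ : IsVanishingOn T V₂) (ho₁ : IsOpen V₁) (ho₂ : IsOpen V₂) :
    IsVanishingOn T (V₁ ∪ V₂) := by
  intro u hu
  -- `χ` is `0` near the part of `tsupport u` outside `V₁` and `1` near the part outside `V₂`, so `χ
  -- u` and `(1 - χ) u` are supported in `V₁` and `V₂`.
  obtain ⟨χ, hχ₀, hχ₁, -⟩ := exists_contMDiffMap_zero_one_nhds_of_isClosed (n := (⊤ : ℕ∞)) 𝓘(ℝ, E)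
    (ho₁.isClosed_compl.inter (isClosed_tsupport u))
    (ho₂.isClosed_compl.inter (isClosed_tsupport u)) (by
      rw [Set.disjoint_left]
      rintro x ⟨hx₁, hx⟩ ⟨hx₂, -⟩
      exact (hu hx).elim hx₁ hx₂)
  have hχ : ContDiff ℝ ∞ χ := χ.contMDiff.contDiff
  have hmul {ρ : E → ℝ} (hρ : ContDiff ℝ ∞ ρ) : ∃ v : 𝓓(Ω, ℝ), ∀ x, v x = ρ x * u x :=
    ⟨⟨fun x => ρ x * u x, hρ.mul u.contDiff, u.hasCompactSupport.mul_left,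
      (tsupport_mul_subset_right).trans u.tsupport_subset⟩, fun _ => rfl⟩
  have hsub {ρ : E → ℝ} {V : Set E} {v : 𝓓(Ω, ℝ)} (hv : ∀ x, v x = ρ x * u x)
      (hρ : ∀ᶠ x in 𝓝ˢ (Vᶜ ∩ tsupport u), ρ x = 0) : tsupport v ⊆ V := by
    intro x hx
    by_contra hxV
    have hxu : x ∈ tsupport u :=
      tsupport_mul_subset_right (f := ρ) (by rwa [← funext hv])
    refine notMem_tsupport_iff_eventuallyEq.2 ?_ hx
    filter_upwards [eventually_nhdsSet_iff_forall.1 hρ x ⟨hxV, hxu⟩] with z hz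
    simp [hv, hz]
  obtain ⟨v₁, hv₁⟩ := hmul hχ
  obtain ⟨v₂, hv₂⟩ := hmul (contDiff_const (c := (1 : ℝ)).sub hχ)
  have huv : u = v₁ + v₂ := by
    ext x
    simp only [add_apply, hv₁, hv₂]
    ring
  rw [huv, map_add, h₁ v₁ (hsub hv₁ hχ₀), h₂ v₂ (hsub hv₂ ?_), add_zero]
  filter_upwards [hχ₁] with x hx
  simp [hx]

/-- A distribution vanishes on test functions whose support does not meet its own. -/
theorem apply_eq_zero_of_disjoint [FiniteDimensional ℝ E] (T : 𝓓'(Ω, F)) (u : 𝓓(Ω, ℝ))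
    (h : Disjoint (tsupport u) (dsupport T)) : T u = 0 := by
  obtain ⟨V, -, huV, hV⟩ : ∃ V : Set E, IsOpen V ∧ tsupport u ⊆ V ∧ IsVanishingOn T V := by
    refine IsCompact.induction_on (p := fun s => ∃ V : Set E, IsOpen V ∧ s ⊆ V ∧ IsVanishingOn T V)
      u.hasCompactSupport ⟨∅, isOpen_empty, subset_rfl, fun v hv => ?_⟩
      (fun s t hst ⟨V, hV⟩ => ⟨V, hV.1, hst.trans hV.2.1, hV.2.2⟩)
      (fun s t ⟨V, hV⟩ ⟨W, hW⟩ => ⟨V ∪ W, hV.1.union hW.1, union_subset_union hV.2.1 hW.2.1,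
        hV.2.2.union hW.2.2 hV.1 hW.1⟩) fun x hx => ?_
    · have : v = 0 := by
        ext x
        simpa using image_eq_zero_of_notMem_tsupport fun hx => hv hx
      rw [this, map_zero]
    · obtain ⟨V, hV, ho, hxV⟩ := (notMem_dsupport_iff x).1 (Set.disjoint_left.1 h hx)
      exact ⟨V, mem_nhdsWithin_of_mem_nhds (ho.mem_nhds hxV), V, ho, subset_rfl, hV⟩
  exact hV u huV

/-- On test functions supported in a fixed compact set, a distribution has finite order. -/
theorem exists_norm_le {G : Type*} [NormedAddCommGroup G] [NormedSpace ℝ G] (T : 𝓓'(Ω, G))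
    {K : Compacts E} (hK : (K : Set E) ⊆ Ω) : ∃ (s : Finset ℕ) (C : ℝ), 0 ≤ C ∧
      ∀ f : 𝓓_{K}(E, ℝ), ‖T (TestFunction.ofSupportedIn hK f)‖ ≤ C * (s.sup fun i => N[ℝ]_{K, i}) f := by
  let q : Seminorm ℝ 𝓓_{K}(E, ℝ) := (normSeminorm ℝ G).comp
    ((T : 𝓓(Ω, ℝ) →ₗ[ℝ] G) ∘ₗ
    (TestFunction.ofSupportedInCLM ℝ hK : 𝓓_{K}(E, ℝ) →L[ℝ] 𝓓(Ω, ℝ)).toLinearMap)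
  have hq : Continuous q :=
    (map_continuous T).norm.comp (TestFunction.continuous_ofSupportedIn hK)
  obtain ⟨s, C, -, h⟩ :=
    Seminorm.bound_of_continuous (ContDiffMapSupportedIn.withSeminorms ℝ E ℝ ⊤ K) q hq
  exact ⟨s, C, C.2, fun f => h f⟩

end Distribution

namespace MulConv

open TopologicalSpace

variable {d : ℕ}

/-- The continuous linear map `φ ↦ φ (· y)` on test functions. -/
noncomputable def dilateCLM (y : nonzeroReals d) :
    𝓓(nonzeroReals d, ℝ) →L[ℝ] 𝓓(nonzeroReals d, ℝ) :=
  TestFunction.limitCLM ℝ (dilate y)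
    (fun K hK => TestFunction.ofSupportedInCLM ℝ
      (K := ⟨dilationHomeo y ⁻¹' K, (dilationHomeo y).isCompact_preimage.2 K.isCompact⟩)
      (fun x hx i hi => hK hx i (by simp [dilationHomeo, hi])) ∘L
      ContDiffMapSupportedIn.mkCLM ℝ (fun f x => f (x * (y : Fin d → ℝ)))
        (fun _ _ _ => rfl) (fun _ _ _ => rfl)
        (fun f => f.contDiff.comp (contDiff_id.mul contDiff_const))
        (fun f x hx => f.zero_on_compl hx)
        (fun i _ => ⟨{i}, ‖(ContinuousLinearMap.mul ℝ (Fin d → ℝ)).flip y‖ ^ i, by positivity,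
          fun f x _ => by
            have h := ((ContinuousLinearMap.mul ℝ (Fin d → ℝ)).flip
              (y : Fin d → ℝ)).iteratedFDeriv_comp_right f.contDiff x (i := i) (mod_cast le_top)
            refine (congrArg norm h).trans_le
              ((ContinuousMultilinearMap.norm_compContinuousLinearMap_le _ _).trans ?_)
            rw [Finset.prod_const, Finset.card_univ, Fintype.card_fin, mul_comm]
            gcongr
            simpa using! ContDiffMapSupportedIn.norm_iteratedFDeriv_apply_le_seminorm_top ℝ⟩))
    fun _ _ _ => rfl

end MulConv

open TopologicalSpace Filter Topology Set
open scoped ContDiff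

/-! ### Taylor remainders, uniformly with all derivatives -/

section IteratedFDeriv

variable {V W : Type*} [NormedAddCommGroup V] [NormedSpace ℝ V]
  [NormedAddCommGroup W] [NormedSpace ℝ W]

/-- Iterated derivatives commute with directional derivatives. -/
theorem iteratedFDeriv_fderiv_apply {f : V → W} (hf : ContDiff ℝ ∞ f) (w : V) (i : ℕ) :
    iteratedFDeriv ℝ i (fun p => fderiv ℝ f p w) = fun p => fderiv ℝ (iteratedFDeriv ℝ i f) p w := by
  induction i with
  | zero =>
    ext p m
    rw [iteratedFDeriv_zero_eq_comp, iteratedFDeriv_zero_eq_comp, LinearIsometryEquiv.comp_fderiv]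
    rfl
  | succ i ih =>
    have hG : ContDiff ℝ ∞ (iteratedFDeriv ℝ i f) :=
      hf.iteratedFDeriv_right (m := ∞) (mod_cast le_top)
    have hDG : Differentiable ℝ (fderiv ℝ (iteratedFDeriv ℝ i f)) :=
      (hG.fderiv_right (m := ∞) (by simp)).differentiable (by simp)
    funext p
    have hG' : Differentiable ℝ (iteratedFDeriv ℝ (i + 1) f) :=
      (hf.iteratedFDeriv_right (m := ∞) (mod_cast le_top)).differentiable (by simp)
    ext v
    rw [iteratedFDeriv_succ_apply_left, ih, fderiv_clm_apply (hDG p) (differentiableAt_const w),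
      ← fderiv_continuousMultilinear_apply_const_apply (hG' p)]
    simp only [iteratedFDeriv_succ_apply_left]
    rw [fderiv_continuousMultilinear_apply_const_apply
      ((hDG p).clm_apply (differentiableAt_const (v 0))),
      fderiv_clm_apply (hDG p) (differentiableAt_const (v 0))]
    have hsymm : IsSymmSndFDerivAt ℝ (iteratedFDeriv ℝ i f) p :=
      hG.contDiffAt.isSymmSndFDerivAt (by
        rw [minSmoothness_of_isRCLikeNormedField]
        exact WithTop.coe_le_coe.2 (le_top (a := (2 : ℕ∞))))
    simp [hsymm.eq (v 0) w]

/-- The first-order Taylor remainder of a smooth function is `o(w)`, locally uniformly. -/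
theorem ContDiff.eventually_norm_taylor_le {G : V → W} (hG : ContDiff ℝ ∞ G) (p₀ : V) {ε : ℝ}
    (hε : 0 < ε) : ∀ᶠ z : V × V in 𝓝 (0, p₀),
      ‖G (z.2 + z.1) - G z.2 - fderiv ℝ G z.2 z.1‖ ≤ ε * ‖z.1‖ := by
  have hs : HasStrictFDerivAt G (fderiv ℝ G p₀) p₀ :=
    hG.contDiffAt.hasStrictFDerivAt (by simp)
  have h₁ := hs.isLittleO.def (half_pos hε)
  have hlim : Tendsto (fun z : V × V => (z.2 + z.1, z.2)) (𝓝 (0, p₀)) (𝓝 (p₀, p₀)) := by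
    have : Continuous fun z : V × V => (z.2 + z.1, z.2) := by fun_prop
    simpa using this.tendsto (0, p₀)
  have h₂ : ∀ᶠ z : V × V in 𝓝 (0, p₀), ‖fderiv ℝ G z.2 - fderiv ℝ G p₀‖ < ε / 2 := by
    have hc : Continuous fun z : V × V => ‖fderiv ℝ G z.2 - fderiv ℝ G p₀‖ :=
      (((hG.continuous_fderiv (by simp)).comp continuous_snd).sub continuous_const).norm
    refine (hc.tendsto (0, p₀)).eventually_lt_const ?_
    simpa using hε
  filter_upwards [hlim.eventually h₁, h₂] with z hz₁ hz₂
  -- Strict differentiability at `p₀` controls the first bracket, continuity of the derivative the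
  -- second.
  have e : G (z.2 + z.1) - G z.2 - fderiv ℝ G z.2 z.1 =
      (G (z.2 + z.1) - G z.2 - fderiv ℝ G p₀ z.1) - (fderiv ℝ G z.2 - fderiv ℝ G p₀) z.1 := by
    simp
  rw [e]
  refine (norm_sub_le _ _).trans ?_
  have h₃ := (fderiv ℝ G z.2 - fderiv ℝ G p₀).le_of_opNorm_le hz₂.le z.1
  simp only [add_sub_cancel_left] at hz₁
  linarith

/-- The first-order Taylor remainder of a smooth function is `o(w)`, uniformly on compact sets,
together with all its derivatives. -/
theorem IsCompact.eventually_norm_iteratedFDeriv_taylor_le {Φ : V → W} (hΦ : ContDiff ℝ ∞ Φ)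
    {K : Set V} (hK : IsCompact K) (i : ℕ) {ε : ℝ} (hε : 0 < ε) :
    ∀ᶠ w in 𝓝 (0 : V), ∀ p ∈ K,
      ‖iteratedFDeriv ℝ i (fun q => Φ (q + w) - Φ q - fderiv ℝ Φ q w) p‖ ≤ ε * ‖w‖ := by
  set G := iteratedFDeriv ℝ i Φ
  have hG : ContDiff ℝ ∞ G := hΦ.iteratedFDeriv_right (m := ∞) (mod_cast le_top)
  -- Differentiating the remainder of `Φ` gives the remainder of its `i`-th derivative `G`.
  have key (w p : V) : iteratedFDeriv ℝ i (fun q => Φ (q + w) - Φ q - fderiv ℝ Φ q w) p =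
      G (p + w) - G p - fderiv ℝ G p w := by
    have h₁ : ContDiff ℝ i (fun q => Φ (q + w)) :=
      (hΦ.comp (contDiff_id.add contDiff_const)).of_le (mod_cast le_top)
    have h₂ : ContDiff ℝ i Φ := hΦ.of_le (mod_cast le_top)
    have h₃ : ContDiff ℝ i (fun q => fderiv ℝ Φ q w) :=
      ((hΦ.fderiv_right (m := ∞) (by simp)).clm_apply contDiff_const).of_le (mod_cast le_top)
    have h := iteratedFDeriv_sub (h₁.sub h₂) h₃
    refine (congrFun h p).trans ?_
    rw [Pi.sub_apply, iteratedFDeriv_fderiv_apply hΦ]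
    refine congrArg (· - fderiv ℝ G p w) ((congrFun (iteratedFDeriv_sub h₁ h₂) p).trans ?_)
    rw [Pi.sub_apply, iteratedFDeriv_comp_add_right]
  simp only [key]
  refine hK.eventually_forall_of_forall_eventually (P := fun w p =>
    ‖G (p + w) - G p - fderiv ℝ G p w‖ ≤ ε * ‖w‖) fun p₀ _ =>
    hG.eventually_norm_taylor_le p₀ hε

/-- The iterated derivatives of a slice of a function on a product are bounded by those of the
function. -/
theorem norm_iteratedFDeriv_prodMk_left_le {V' : Type*} [NormedAddCommGroup V'] [NormedSpace ℝ V']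
    {R : V' × V → W} (hR : ContDiff ℝ ∞ R) (y : V') (x : V) (i : ℕ) :
    ‖iteratedFDeriv ℝ i (fun x => R (y, x)) x‖ ≤ ‖iteratedFDeriv ℝ i R (y, x)‖ := by
  have h₀ : ContDiff ℝ ∞ fun q => R (q + (y, 0)) := hR.comp (contDiff_id.add contDiff_const)
  have h := (ContinuousLinearMap.inr ℝ V' V).iteratedFDeriv_comp_right h₀ x (i := i)
    (mod_cast le_top)
  rw [iteratedFDeriv_comp_add_right] at h
  have e : (fun q => R (q + (y, 0))) ∘ ContinuousLinearMap.inr ℝ V' V = fun x => R (y, x) := by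
    ext x
    simp
  rw [e] at h
  rw [h]
  refine (ContinuousMultilinearMap.norm_compContinuousLinearMap_le _ _).trans ?_
  rw [show ContinuousLinearMap.inr ℝ V' V x + (y, 0) = (y, x) by simp]
  refine mul_le_of_le_one_right (norm_nonneg _) (Finset.prod_le_one (fun _ _ => norm_nonneg _)
    fun _ _ => ContinuousLinearMap.norm_inr_le_one ℝ V' V)

end IteratedFDeriv

/-- A distribution applied to the first-order Taylor remainder of a smooth family of test functions
supported in a fixed compact set is `o(h)`. -/
theorem Distribution.eventually_norm_taylor_le {E E' G : Type*} [NormedAddCommGroup E]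
    [NormedSpace ℝ E] {Ω : Opens E} [NormedAddCommGroup E'] [NormedSpace ℝ E']
    [NormedAddCommGroup G] [NormedSpace ℝ G] (T : 𝓓'(Ω, G)) {K : Set E} (hK : IsCompact K)
    (hKΩ : K ⊆ Ω) {Φ : E' × E → ℝ} (hΦ : ContDiff ℝ ∞ Φ) (y : E') {ε : ℝ} (hε : 0 < ε) :
    ∀ᶠ h in 𝓝 (0 : E'), ∀ r : 𝓓(Ω, ℝ), (∀ x ∉ K, r x = 0) →
      (∀ x, r x = Φ (y + h, x) - Φ (y, x) - fderiv ℝ Φ (y, x) (h, 0)) → ‖T r‖ ≤ ε * ‖h‖ := by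
  obtain ⟨s, C, hC, hT⟩ := T.exists_norm_le (K := ⟨K, hK⟩) hKΩ
  have hlim : Tendsto (fun h : E' => (h, (0 : E))) (𝓝 0) (𝓝 0) := by
    have : Continuous fun h : E' => (h, (0 : E)) := by fun_prop
    exact this.tendsto' 0 0 rfl
  have hev := (s.eventually_all.2 fun i _ => hlim.eventually
    ((isCompact_singleton (x := y)).prod hK |>.eventually_norm_iteratedFDeriv_taylor_le hΦ i
      (show 0 < ε / (C + 1) by positivity)))
  filter_upwards [hev] with h hh r hrK hr
  let f : 𝓓_{⟨K, hK⟩}(E, ℝ) := ⟨r, r.contDiff, fun x hx => hrK x hx⟩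
  have hbound : (s.sup fun i => N[ℝ]_{⟨K, hK⟩, i}) f ≤ ε / (C + 1) * ‖h‖ := by
    refine Seminorm.finset_sup_apply_le (by positivity) fun i hi => ?_
    rw [ContDiffMapSupportedIn.seminorm_top_le_iff ℝ (by positivity)]
    intro x hx
    have hR : ContDiff ℝ ∞ fun q => Φ (q + (h, 0)) - Φ q - fderiv ℝ Φ q (h, 0) :=
      ((hΦ.comp (contDiff_id.add contDiff_const)).sub hΦ).sub
        ((hΦ.fderiv_right (m := ∞) (by simp)).clm_apply contDiff_const)
    have h₁ := norm_iteratedFDeriv_prodMk_left_le hR y x i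
    have h₂ := hh i hi (y, x) ⟨rfl, hx⟩
    have e : (f : E → ℝ) = fun x => Φ ((y, x) + (h, 0)) - Φ (y, x) - fderiv ℝ Φ (y, x) (h, 0) := by
      ext x
      simpa using! hr x
    rw [e]
    simpa using h₁.trans h₂
  calc ‖T r‖ ≤ C * (s.sup fun i => N[ℝ]_{⟨K, hK⟩, i}) f := hT f
    _ ≤ C * (ε / (C + 1) * ‖h‖) := by gcongr
    _ = (C / (C + 1)) * (ε * ‖h‖) := by ring
    _ ≤ 1 * (ε * ‖h‖) := by
      gcongr
      rw [div_le_one (by positivity)]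
      linarith
    _ = ε * ‖h‖ := one_mul _

/-! ### Smoothness and support of `y ↦ T_x φ(x y)` -/

namespace MulConv

open TopologicalSpace Filter Topology Set
open scoped ContDiff

variable {𝕜 : Type*} [RCLike 𝕜] {d : ℕ}

/-- The test function `x ↦ xᵢ ∂ᵢφ(x)`. -/
noncomputable def eulerDeriv (i : Fin d) (φ : 𝓓(nonzeroReals d, ℝ)) : 𝓓(nonzeroReals d, ℝ) where
  toFun x := x i * fderiv ℝ φ x (Pi.single i 1)
  contDiff' := (contDiff_apply ℝ ℝ i).mul
    ((φ.contDiff.fderiv_right (m := ∞) (by simp)).clm_apply contDiff_const)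
  hasCompactSupport' := (φ.hasCompactSupport.fderiv_apply ℝ _).mul_left
  tsupport_subset' := tsupport_mul_subset_right.trans
    ((tsupport_fderiv_apply_subset ℝ _).trans φ.tsupport_subset)

theorem eulerDeriv_apply (i : Fin d) (φ : 𝓓(nonzeroReals d, ℝ)) (x : Fin d → ℝ) :
    eulerDeriv i φ x = x i * fderiv ℝ φ x (Pi.single i 1) := rfl

theorem dilate_apply (y : nonzeroReals d) (φ : 𝓓(nonzeroReals d, ℝ)) (x : Fin d → ℝ) :
    dilate y φ x = φ (x * (y : Fin d → ℝ)) := rfl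

theorem mul_mem_nonzeroReals {x y : Fin d → ℝ} (hx : x ∈ nonzeroReals d)
    (hy : y ∈ nonzeroReals d) : x * y ∈ nonzeroReals d :=
  fun i => mul_ne_zero (hx i) (hy i)

theorem inv_mem_nonzeroReals {x : Fin d → ℝ} (hx : x ∈ nonzeroReals d) :
    x⁻¹ ∈ nonzeroReals d :=
  fun i => inv_ne_zero (hx i)

theorem mul_mul_inv_cancel {y : Fin d → ℝ} (hy : y ∈ nonzeroReals d) (x : Fin d → ℝ) :
    x * y * y⁻¹ = x := by
  ext i
  simp [hy i]

theorem mul_inv_mul_cancel {y : Fin d → ℝ} (hy : y ∈ nonzeroReals d) (x : Fin d → ℝ) :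
    x * y⁻¹ * y = x := by
  ext i
  simp [hy i]

theorem continuousOn_inv_nonzeroReals :
    ContinuousOn (fun x : Fin d → ℝ => x⁻¹) (nonzeroReals d) :=
  continuousOn_pi.2 fun i => (continuous_apply i).continuousOn.inv₀ fun _ hx => hx i

/-- The set `(1 / A) K` is compact for compact `A` and `K`. -/
theorem isCompact_image2_inv_mul {A K : Set (Fin d → ℝ)} (hA : IsCompact A)
    (hAΩ : A ⊆ nonzeroReals d) (hK : IsCompact K) :
    IsCompact (image2 (fun x k => x⁻¹ * k) A K) := by
  rw [← image_prod]
  refine (hA.prod hK).image_of_continuousOn ?_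
  exact ((continuousOn_inv_nonzeroReals.mono hAΩ).comp continuousOn_fst
    fun _ h => h.1).mul continuousOn_snd

theorem image2_inv_mul_subset {A K : Set (Fin d → ℝ)} (hA : A ⊆ nonzeroReals d)
    (hK : K ⊆ nonzeroReals d) : image2 (fun x k => x⁻¹ * k) A K ⊆ nonzeroReals d :=
  image2_subset_iff.2 fun _ hx _ hk => mul_mem_nonzeroReals (inv_mem_nonzeroReals (hA hx)) (hK hk)

open scoped Classical in
/-- The function `y ↦ T_x φ(x y)` on `(ℝ ∖ {0})^d`, extended by `0` to `ℝ^d`. -/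
noncomputable def pairing (T : 𝓓'(nonzeroReals d, 𝕜)) (φ : 𝓓(nonzeroReals d, ℝ)) (y : Fin d → ℝ) : 𝕜 :=
  if h : y ∈ nonzeroReals d then T (dilate ⟨y, h⟩ φ) else 0

theorem pairing_of_mem (T : 𝓓'(nonzeroReals d, 𝕜)) (φ : 𝓓(nonzeroReals d, ℝ)) {y : Fin d → ℝ}
    (h : y ∈ nonzeroReals d) : pairing T φ y = T (dilate ⟨y, h⟩ φ) :=
  dif_pos h

/-- Differentiating under `T` gives `∂φ(x y)/∂yᵢ = xᵢ (∂ᵢφ)(x y)`, which is `yᵢ⁻¹` times the dilate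
of `eulerDeriv i φ`. The derivative thus involves pairings of the same form, which permits induction
on the order. -/
theorem hasFDerivAt_pairing (T : 𝓓'(nonzeroReals d, 𝕜)) (φ : 𝓓(nonzeroReals d, ℝ))
    {y : Fin d → ℝ} (hy : y ∈ nonzeroReals d) :
    HasFDerivAt (pairing T φ) (∑ i, (ContinuousLinearMap.proj i : (Fin d → ℝ) →L[ℝ] ℝ).smulRight
      ((y i)⁻¹ • pairing T (eulerDeriv i φ) y)) y := by
  rw [hasFDerivAt_iff_isLittleO_nhds_zero, Asymptotics.isLittleO_iff]
  intro ε hε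
  obtain ⟨δ, hδ, hB⟩ := Metric.nhds_basis_closedBall.mem_iff.1
    ((nonzeroReals d).isOpen.mem_nhds hy)
  have hBc : IsCompact (Metric.closedBall y δ) := isCompact_closedBall y δ
  have hΦ : ContDiff ℝ ∞ fun p : (Fin d → ℝ) × (Fin d → ℝ) => φ (p.2 * p.1) :=
    φ.contDiff.comp (contDiff_snd.mul contDiff_fst)
  have hΦ' (x h : Fin d → ℝ) :
      fderiv ℝ (fun p : (Fin d → ℝ) × (Fin d → ℝ) => φ (p.2 * p.1)) (y, x) (h, 0) =
        fderiv ℝ φ (x * y) (x * h) := by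
    have h₁ : HasFDerivAt φ (fderiv ℝ φ (x * y)) (x * y) :=
      (φ.contDiff.differentiable (by simp) _).hasFDerivAt
    have h₂ := (hasFDerivAt_snd (𝕜 := ℝ) (p := (y, x))).mul
      (hasFDerivAt_fst (𝕜 := ℝ) (p := (y, x)))
    have h₃ := (h₁.comp (y, x) h₂).fderiv
    refine (DFunLike.congr_fun h₃ (h, 0)).trans ?_
    simp
  -- One compact set carrying `φ (· b)` for all `b` in the ball around `y`.
  have hK := isCompact_image2_inv_mul hBc hB φ.hasCompactSupport
  have hnear : ∀ᶠ h in 𝓝 (0 : Fin d → ℝ), y + h ∈ Metric.closedBall y δ := by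
    filter_upwards [Metric.closedBall_mem_nhds (0 : Fin d → ℝ) hδ] with h hh
    simpa using hh
  filter_upwards [hnear, T.eventually_norm_taylor_le hK
    (image2_inv_mul_subset hB φ.tsupport_subset) hΦ y hε] with h hh hT
  have hyh := hB hh
  set r : 𝓓(nonzeroReals d, ℝ) := dilate ⟨y + h, hyh⟩ φ - dilate ⟨y, hy⟩ φ -
    ∑ i, (h i * (y i)⁻¹) • dilate ⟨y, hy⟩ (eulerDeriv i φ) with hr
  have hr_apply (x : Fin d → ℝ) : r x = φ (x * (y + h)) - φ (x * y) -
      ∑ i, h i * (y i)⁻¹ * ((x i * y i) * fderiv ℝ φ (x * y) (Pi.single i 1)) := by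
    simp [hr, dilate_apply, eulerDeriv_apply]
  have hoff {b x : Fin d → ℝ} (hb : b ∈ Metric.closedBall y δ)
      (hx : x ∉ image2 (fun x k => x⁻¹ * k) (Metric.closedBall y δ) (tsupport φ)) :
      x * b ∉ tsupport φ :=
    fun h => hx ⟨b, hb, x * b, h, by
      change b⁻¹ * (x * b) = x
      rw [mul_comm, mul_mul_inv_cancel (hB hb)]⟩
  have hTr : T r = pairing T φ (y + h) - pairing T φ y -
      (∑ i, (ContinuousLinearMap.proj i : (Fin d → ℝ) →L[ℝ] ℝ).smulRight
        ((y i)⁻¹ • pairing T (eulerDeriv i φ) y)) h := by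
    simp [hr, pairing_of_mem T _ hy, pairing_of_mem T _ hyh, smul_smul]
  rw [← hTr]
  refine hT r (fun x hx => ?_) fun x => ?_
  · have h₁ := hoff hh hx
    have h₂ := hoff (Metric.mem_closedBall_self hδ.le) hx
    rw [hr_apply, image_eq_zero_of_notMem_tsupport h₁, image_eq_zero_of_notMem_tsupport h₂,
      fderiv_of_notMem_tsupport ℝ h₂]
    simp
  · rw [hr_apply, hΦ']
    congr 1
    conv_rhs => rw [pi_eq_sum_univ' (x * h), map_sum]
    refine Finset.sum_congr rfl fun i _ => ?_
    simp only [map_smul, smul_eq_mul, Pi.mul_apply]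
    have := hy i
    field_simp

theorem contDiffOn_pairing (T : 𝓓'(nonzeroReals d, 𝕜)) (φ : 𝓓(nonzeroReals d, ℝ)) :
    ContDiffOn ℝ ∞ (pairing T φ) (nonzeroReals d) := by
  refine contDiffOn_infty.2 fun n => ?_
  induction n generalizing φ with
  | zero =>
    exact contDiffOn_zero.2 fun y hy =>
      (hasFDerivAt_pairing T φ hy).continuousAt.continuousWithinAt
  | succ n ih =>
    push_cast
    refine (contDiffOn_succ_iff_hasFDerivWithinAt_of_uniqueDiffOn
      (nonzeroReals d).isOpen.uniqueDiffOn).2 ⟨by simp, _, ?_, fun y hy =>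
        (hasFDerivAt_pairing T φ hy).hasFDerivWithinAt⟩
    refine ContDiffOn.sum fun i _ => contDiffOn_const.smulRight ?_
    exact (((contDiff_apply ℝ ℝ i).contDiffOn).inv
      fun y (hy : y ∈ (nonzeroReals d : Set (Fin d → ℝ))) => hy i).smul (ih _)

/-- A distribution with compact support maps test functions to test functions. -/
theorem PreservesTestFunctions.of_isCompact_support {T : 𝓓'(nonzeroReals d, 𝕜)}
    (hT : IsCompact (support T)) : PreservesTestFunctions T := by
  intro φ
  have hK := isCompact_image2_inv_mul hT inter_subset_right φ.hasCompactSupport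
  have hKΩ := image2_inv_mul_subset (A := support T) inter_subset_right φ.tsupport_subset
  set K := image2 (fun x k => x⁻¹ * k) (support T) (tsupport φ)
  have hzero (y) (hy : y ∉ K) : pairing T φ y = 0 := by
    by_cases hyΩ : y ∈ nonzeroReals d
    · rw [pairing_of_mem T φ hyΩ]
      refine Distribution.apply_eq_zero_of_disjoint T _ (Set.disjoint_left.2 fun x hx hxT => hy ?_)
      have hxΩ := (dilate ⟨y, hyΩ⟩ φ).tsupport_subset hx
      refine ⟨x, ⟨hxT, hxΩ⟩, x * y,
        tsupport_comp_subset_preimage φ (dilationHomeo ⟨y, hyΩ⟩).continuous hx, ?_⟩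
      change x⁻¹ * (x * y) = y
      rw [mul_comm x y, mul_comm, mul_mul_inv_cancel hxΩ]
    · exact dif_neg hyΩ
  have hsub : tsupport (pairing T φ) ⊆ K :=
    closure_minimal (fun y hy => by_contra fun h => hy (hzero y h)) hK.isClosed
  have hsmooth : ContDiff ℝ ∞ (pairing T φ) := by
    refine contDiff_iff_contDiffAt.2 fun y => ?_
    by_cases hy : y ∈ K
    · exact (contDiffOn_pairing T φ).contDiffAt ((nonzeroReals d).isOpen.mem_nhds (hKΩ hy))
    · refine contDiffAt_const (c := (0 : 𝕜)) |>.congr_of_eventuallyEq ?_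
      filter_upwards [hK.isClosed.isOpen_compl.mem_nhds hy] using hzero
  exact ⟨⟨pairing T φ, hsmooth, hK.of_isClosed_subset (isClosed_tsupport _) hsub, hsub.trans hKΩ⟩,
    fun y => pairing_of_mem T φ y.2⟩

/-! ### Exhaustion by boxes and necessity of compact support -/

/-- The points of `ℝ^d` all of whose coordinates have absolute value in `[1 / (n + 1), n + 1]`. -/
def box (d n : ℕ) : Set (Fin d → ℝ) :=
  {x | ∀ i, |x i| ≤ n + 1 ∧ 1 ≤ (n + 1) * |x i|}

theorem box_subset (n : ℕ) : box d n ⊆ nonzeroReals d := by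
  intro x hx i hi
  have := (hx i).2
  simp [hi] at this
  linarith

theorem isCompact_box (n : ℕ) : IsCompact (box d n) := by
  refine Metric.isCompact_of_isClosed_isBounded ?_ ?_
  · simp only [box, Set.ofPred_forall]
    refine isClosed_iInter fun i => ?_
    have h : Continuous fun x : Fin d → ℝ => |x i| := by fun_prop
    exact (isClosed_le h continuous_const).inter
      (isClosed_le continuous_const (continuous_const.mul h))
  · refine (Metric.isBounded_iff_subset_closedBall 0).2 ⟨n + 1, fun x hx => ?_⟩
    rw [mem_closedBall_zero_iff, pi_norm_le_iff_of_nonneg (by positivity)]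
    exact fun i => (hx i).1

theorem inv_mem_box {n : ℕ} {x : Fin d → ℝ} (hx : x ∈ box d n) : x⁻¹ ∈ box d n := by
  intro i
  have h0 : 0 < |x i| := abs_pos.2 (box_subset n hx i)
  have := hx i
  rw [Pi.inv_apply, abs_inv]
  refine ⟨?_, ?_⟩
  · rw [inv_le_iff_one_le_mul₀ h0]
    exact this.2
  · rw [← div_eq_mul_inv, one_le_div h0]
    exact this.1

/-- The boxes exhaust `(ℝ ∖ {0})^d`. -/
theorem exists_subset_box {K : Set (Fin d → ℝ)} (hK : IsCompact K) (hKΩ : K ⊆ nonzeroReals d) :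
    ∃ N, ∀ n ≥ N, K ⊆ box d n := by
  obtain ⟨A, hA⟩ := hK.exists_bound_of_continuousOn continuousOn_id
  obtain ⟨B, hB⟩ := hK.exists_bound_of_continuousOn (continuousOn_inv_nonzeroReals.mono hKΩ)
  obtain ⟨N, hN⟩ := exists_nat_ge (max A B)
  refine ⟨N, fun n hn x hx i => ?_⟩
  have h0 : 0 < |x i| := abs_pos.2 (hKΩ hx i)
  have hNn : (N : ℝ) ≤ n := mod_cast hn
  have h₁ : |x i| ≤ A := (norm_le_pi_norm x i).trans (hA x hx)
  have h₂ : |x i|⁻¹ ≤ B := by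
    rw [← abs_inv]
    exact (norm_le_pi_norm x⁻¹ i).trans (hB x hx)
  have h₃ := le_max_left A B
  have h₄ := le_max_right A B
  refine ⟨by linarith, ?_⟩
  rw [← inv_le_iff_one_le_mul₀ h0]
  linarith

/-- A distribution mapping test functions to test functions has compact support. -/
theorem PreservesTestFunctions.isCompact_support {T : 𝓓'(nonzeroReals d, 𝕜)}
    (hT : PreservesTestFunctions T) : IsCompact (support T) := by
  by_cases hbox : ∃ n, support T ⊆ box d n
  · obtain ⟨n, hn⟩ := hbox
    have : support T = Distribution.dsupport T ∩ box d n :=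
      Subset.antisymm (fun x hx => ⟨hx.1, hn hx⟩) fun x hx => ⟨hx.1, box_subset n hx.2⟩
    rw [this]
    exact (isCompact_box n).inter_left Distribution.isClosed_dsupport
  exfalso
  simp only [not_exists, not_subset] at hbox
  choose x hx hxn using hbox
  have hone : (1 : Fin d → ℝ) ∈ nonzeroReals d := fun i => one_ne_zero
  obtain ⟨δ, hδ, hB⟩ := Metric.nhds_basis_closedBall.mem_iff.1
    ((nonzeroReals d).isOpen.mem_nhds hone)
  have hBc : IsCompact (Metric.closedBall (1 : Fin d → ℝ) δ) := isCompact_closedBall 1 δ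
  have hbump (n) : ∃ u : 𝓓(nonzeroReals d, ℝ),
      tsupport u ⊆ (fun z => z * (x n)⁻¹) ⁻¹' Metric.ball 1 δ ∧ T u ≠ 0 := by
    refine (Distribution.mem_dsupport_iff_forall_exists_ne (x n)).1 (hx n).1 _ ?_
      (Metric.isOpen_ball.preimage (by fun_prop))
    have := mul_mul_inv_cancel (hx n).2 1
    rw [one_mul] at this
    simp [this, hδ]
  choose u hu hTu using hbump
  let y (n : ℕ) : nonzeroReals d := ⟨(x n)⁻¹, inv_mem_nonzeroReals (hx n).2⟩
  -- `u n` pulled back from near `x n` to the fixed ball around `1`; dilating by `y n` recovers `u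
  -- n`.
  let f (n : ℕ) : 𝓓_{⟨Metric.closedBall (1 : Fin d → ℝ) δ, hBc⟩}(Fin d → ℝ, ℝ) :=
    .of_support_subset (dilate ⟨x n, (hx n).2⟩ (u n)).contDiff fun z hz => by
      have h := hu n (subset_tsupport _ (show z * x n ∈ Function.support (u n) from hz))
      rw [mem_preimage, mul_mul_inv_cancel (hx n).2] at h
      exact Metric.ball_subset_closedBall h
  obtain ⟨g, hg⟩ := ContDiffMapSupportedIn.exists_frequently_ne_zero
    (fun n => (T : 𝓓(nonzeroReals d, ℝ) →L[ℝ] 𝕜) ∘L dilateCLM (y n) ∘L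
      TestFunction.ofSupportedInCLM ℝ hB) f fun n => by
    have : dilate (y n) (TestFunction.ofSupportedIn hB (f n)) = u n := by
      ext z
      exact congrArg (u n) (mul_inv_mul_cancel (hx n).2 z)
    change T (dilate (y n) (TestFunction.ofSupportedIn hB (f n))) ≠ 0
    rw [this]
    exact hTu n
  obtain ⟨ψ, hψ⟩ := hT (TestFunction.ofSupportedIn hB g)
  obtain ⟨N, hN⟩ := exists_subset_box ψ.hasCompactSupport ψ.tsupport_subset
  obtain ⟨n, hn, hnN⟩ := (hg.and_eventually (eventually_ge_atTop N)).exists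
  have hmem : (x n)⁻¹ ∈ tsupport ψ := by
    refine subset_tsupport _ ?_
    rw [Function.mem_support]
    exact (hψ (y n)).trans_ne hn
  -- Boxes are invariant under inversion, so `(x n)⁻¹ ∈ box d n` would put `x n` in `box d n`.
  exact hxn n (by simpa using inv_mem_box (hN n hnN hmem))

end MulConv

theorem lemma5p1 (𝕜 : Type*) [RCLike 𝕜] (d : ℕ) :
    MulConv.hadamardDistributions 𝕜 d = MulConv.compactlySupported 𝕜 d ∧
    ∀ T : 𝓓'(MulConv.nonzeroReals d, 𝕜),
      MulConv.PreservesTestFunctions T → T ∈ MulConv.compactlySupported 𝕜 d := by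
  refine ⟨Set.Subset.antisymm (fun T hT => hT.1.isCompact_support) fun T hT => ?_,
    fun T hT => hT.isCompact_support⟩
  refine ⟨.of_isCompact_support hT, fun K hK hKΩ => ?_⟩
  have h := MulConv.isCompact_image2_inv_mul hT Set.inter_subset_right hK
  rw [MulConv.IsRelativelyCompactIn, h.isClosed.closure_eq]
  exact ⟨h, MulConv.image2_inv_mul_subset Set.inter_subset_right hKΩ⟩
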